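/- Setting. An operational probabilistic theory consists of systems, events and tests that can be composed sequentially and in parallel (a symmetric monoidal category; a test is a family of events indexed by a finite set of classical outcomes; outcomes of a test can be coarse-grained; closed circuits have probabilities that add up to one over the outcomes of a closed test and multiply for independent circuits). It is assumed to be non-signalling: every system can be discarded in exactly one way (it has exactly one single-outcome measurement). Let $1\le m<n$. A generalized Bayesian network (GBN) of shape $\mathcal G_{n,m}$ consists of $n$ measurement tests with finite outcome sets, whose outcomes are the random variables $V_1,\dots,V_n$, and, for each set $I\subset\{1,\dots,n\}$ with $|I|=m$, one preparation test $\sigma_I$ with a single event, whose output systems are inputs of exactly the measurements $i\in I$. A joint distribution is compatible with $\mathcal G_{n,m}$ if it is the outcome distribution of such a network. $H$ denotes the Shannon entropy in bits and $I(X:Y)=H(X)+H(Y)-H(X,Y)$. Theorem. Let $m\ge 1$. (1) If $V_1,\dots,V_{m+1}$ are random variables arising from a GBN of shape $\mathcal G_{m+1,m}$, then $$\sum_{k=2}^{m+1} I(V_1:V_k)\;\le\;\sum_{k=0}^{m-2}\frac{(m-k-1)\,(m-k-1)!}{(m-1)!}\,H(V_{k+1}),$$ where an empty sum is $0$. (2)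 If $X$ is an unbiased coin and $X_1=\dots=X_{m+1}=X$, then $X_1,\dots,X_{m+1}$ violate this inequality; in particular they are incompatible with $\mathcal G_{m+1,m}$. (3) Consequently every $\mathcal G_{n,m}$ with $n>m$ has nontrivial entropic constraints: for variables from a GBN of shape $\mathcal G_{n,m}$ the inequality holds for any $m+1$ distinct variables among the $n$, taken in any order, whereas $n$ copies of one unbiased coin violate it for every such choice and are incompatible with $\mathcal G_{n,m}$. -/

import Mathlib

open CategoryTheory MonoidalCategory

universe u v

noncomputable section

/-! ### Operational probabilistic theories -/

/-- A (causal, i.e. non-signalling) operational probabilistic theory whose systems are the objects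
and whose events are the morphisms of a symmetric monoidal category: composition is sequential
composition (connecting outputs to inputs), the tensor product is parallel composition and the
tensor unit is the trivial system. A test from `A` to `B` with finite outcome set `X` is a family
`X → (A ⟶ B)` of events, one for each classical outcome. -/
structure CausalOPT (C : Type u) [Category.{v} C] [MonoidalCategory C] [SymmetricCategory C] where
  /-- The families of events that are tests. -/
  IsTest : ∀ {X : Type} [Finite X] {A B : C}, (X → (A ⟶ B)) → Prop
  /-- The probability of a closed circuit. -/
  prob : (𝟙_ C ⟶ 𝟙_ C) → ℝ
  /-- Every event occurs in some test. -/
  event_mem : ∀ {A B : C} (f : A ⟶ B), ∃ (X : Type) (_ : Finite X) (t : X → (A ⟶ B)) (x : X),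
    IsTest t ∧ t x = f
  /-- Doing nothing and rearranging systems are tests with a single outcome. -/
  test_id : ∀ A : C, IsTest (fun _ : Unit => 𝟙 A)
  test_braiding : ∀ A B : C, IsTest (fun _ : Unit => (β_ A B).hom)
  test_associator : ∀ A B D : C, IsTest (fun _ : Unit => (α_ A B D).hom)
  test_associator_inv : ∀ A B D : C, IsTest (fun _ : Unit => (α_ A B D).inv)
  test_leftUnitor : ∀ A : C, IsTest (fun _ : Unit => (λ_ A).hom)
  test_leftUnitor_inv : ∀ A : C, IsTest (fun _ : Unit => (λ_ A).inv)
  test_rightUnitor : ∀ A : C, IsTest (fun _ : Unit => (ρ_ A).hom)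
  test_rightUnitor_inv : ∀ A : C, IsTest (fun _ : Unit => (ρ_ A).inv)
  /-- Outcomes may be renamed. -/
  test_relabel : ∀ {X Y : Type} [Finite X] [Finite Y] {A B : C} (t : X → (A ⟶ B)) (e : Y ≃ X),
    IsTest t → IsTest (fun y => t (e y))
  /-- Sequential composition of tests. -/
  test_comp : ∀ {X Y : Type} [Finite X] [Finite Y] {A B D : C}
    (s : X → (A ⟶ B)) (t : Y → (B ⟶ D)), IsTest s → IsTest t →
    IsTest (fun z : X × Y => s z.1 ≫ t z.2)
  /-- Parallel composition of tests. -/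
  test_tensor : ∀ {X Y : Type} [Finite X] [Finite Y] {A B A' B' : C}
    (s : X → (A ⟶ B)) (t : Y → (A' ⟶ B')), IsTest s → IsTest t →
    IsTest (fun z : X × Y => s z.1 ⊗ₘ t z.2)
  /-- Coarse-graining: outcomes of a test may be joined together, and in every circuit the
  probability of the joint outcome is the sum of the probabilities. -/
  coarseGrain : ∀ {X Y : Type} [Fintype X] [Fintype Y] [DecidableEq Y] {A B : C}
    (t : X → (A ⟶ B)) (c : X → Y), Function.Surjective c → IsTest t →
    ∃ s : Y → (A ⟶ B), IsTest s ∧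
      ∀ (E : C) (r : 𝟙_ C ⟶ A ⊗ E) (a : B ⊗ E ⟶ 𝟙_ C) (y : Y),
        prob (r ≫ (s y ▷ E) ≫ a) =
          ∑ x ∈ Finset.univ.filter (fun x => c x = y), prob (r ≫ (t x ▷ E) ≫ a)
  /-- Closed circuits have probabilities, and independent ones multiply. -/
  prob_nonneg : ∀ a : 𝟙_ C ⟶ 𝟙_ C, 0 ≤ prob a
  prob_comp : ∀ a b : 𝟙_ C ⟶ 𝟙_ C, prob (a ≫ b) = prob a * prob b
  /-- The outcome probabilities of a closed test add up to one. -/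
  sum_prob : ∀ {X : Type} [Fintype X] (t : X → (𝟙_ C ⟶ 𝟙_ C)), IsTest t → ∑ x, prob (t x) = 1
  /-- Causality: every system can be discarded in exactly one way, that is, there is exactly one
  measurement on it with a single outcome. -/
  existsUnique_discard : ∀ A : C, ∃! d : A ⟶ 𝟙_ C, IsTest (fun _ : Unit => d)

/-! ### Wiring of preparations and measurements -/

section Wiring

variable {C : Type u} [Category.{v} C] [MonoidalCategory C]

/-- The composite system `A 0 ⊗ (A 1 ⊗ (⋯ ⊗ 𝟙))`. -/
def tensorFin : (n : ℕ) → (Fin n → C) → C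
  | 0, _ => 𝟙_ C
  | n + 1, A => A 0 ⊗ tensorFin n (fun i => A i.succ)

/-- The parallel composition of the effects `e 0, e 1, …`. -/
def effectFin : (n : ℕ) → (A : Fin n → C) → (∀ i, A i ⟶ 𝟙_ C) → (tensorFin n A ⟶ 𝟙_ C)
  | 0, _, _ => 𝟙 (𝟙_ C)
  | n + 1, A, e =>
      (e 0 ⊗ₘ effectFin n (fun i => A i.succ) (fun i => e i.succ)) ≫ (λ_ (𝟙_ C)).hom

/-- The identification of the trivial system with `n` copies of it. -/
def unitFin : (n : ℕ) → (𝟙_ C ⟶ tensorFin n (fun _ : Fin n => 𝟙_ C))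
  | 0 => 𝟙 (𝟙_ C)
  | n + 1 => (λ_ (𝟙_ C)).inv ≫ (𝟙_ C ◁ unitFin n)

/-- The rearrangement of systems that brings together the two systems of each of `n` parties. -/
def zipFin [SymmetricCategory C] : (n : ℕ) → (A B : Fin n → C) →
    (tensorFin n A ⊗ tensorFin n B ⟶ tensorFin n (fun i => A i ⊗ B i))
  | 0, _, _ => (λ_ (𝟙_ C)).hom
  | n + 1, A, B =>
      tensorμ (A 0) (tensorFin n (fun i => A i.succ)) (B 0) (tensorFin n (fun i => B i.succ)) ≫
        ((A 0 ⊗ B 0) ◁ zipFin n (fun i => A i.succ) (fun i => B i.succ))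

/-- The joint preparation by `N` independent sources, where source `s` sends the system `A s i` to
party `i`: party `i` ends up with the composite of the systems `A s i`, `s : Fin N`. -/
def jointPreparation [SymmetricCategory C] (n : ℕ) : (N : ℕ) → (A : Fin N → Fin n → C) →
    (∀ s, 𝟙_ C ⟶ tensorFin n (A s)) →
    (𝟙_ C ⟶ tensorFin n (fun i => tensorFin N (fun s => A s i)))
  | 0, _, _ => unitFin n
  | N + 1, A, σ =>
      (λ_ (𝟙_ C)).inv ≫
        (σ 0 ⊗ₘ jointPreparation n N (fun s => A s.succ) (fun s => σ s.succ)) ≫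
        zipFin n (A 0) (fun i => tensorFin N (fun s => A s.succ i))

/-- The system that a source connecting exactly the parties in `I` sends to party `i`: the system
`S i` if `i ∈ I`, and the trivial system (no edge) otherwise. -/
def legs {n : ℕ} (I : Finset (Fin n)) (S : Fin n → C) (i : Fin n) : C :=
  if i ∈ I then S i else 𝟙_ C

end Wiring

/-! ### Generalized Bayesian networks of shape `G_{n,m}` -/

section GBN

variable {C : Type u} [Category.{v} C] [MonoidalCategory C] [SymmetricCategory C]

/-- A generalized Bayesian network of shape `G_{n,m}` in the theory `T`, with outcome sets `V i`:
for each set `I` of exactly `m` of the `n` parties there is one preparation test with a single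
event, whose output systems are inputs for exactly the measurements of the parties in `I`; party
`i` performs a measurement test with outcomes in `V i` on all the systems it receives. -/
structure GBN (T : CausalOPT C) (n m : ℕ) (V : Fin n → Type) [∀ i, Fintype (V i)] where
  /-- A list, in some immaterial order, of the sets of `m` parties. -/
  order : Fin (n.choose m) ≃ {I : Finset (Fin n) // I.card = m}
  /-- The system sent to party `i` by the source shared by the parties in `I`. -/
  sys : Finset (Fin n) → Fin n → C
  /-- The preparations. -/
  prep : ∀ s, 𝟙_ C ⟶ tensorFin n (legs (order s).1 (sys (order s).1))
  prep_test : ∀ s, T.IsTest (fun _ : Unit => prep s)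
  /-- The measurements. -/
  meas : ∀ i, V i →
    (tensorFin (n.choose m) (fun s => legs (order s).1 (sys (order s).1) i) ⟶ 𝟙_ C)
  meas_test : ∀ i, T.IsTest (meas i)

/-- The closed circuit of the network in which party `i` observes the outcome `x i`. -/
def GBN.circuit {T : CausalOPT C} {n m : ℕ} {V : Fin n → Type} [∀ i, Fintype (V i)]
    (G : GBN T n m V) (x : ∀ i, V i) : 𝟙_ C ⟶ 𝟙_ C :=
  jointPreparation n (n.choose m) (fun s => legs (G.order s).1 (G.sys (G.order s).1)) G.prep ≫
    effectFin n _ (fun i => G.meas i (x i))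

/-- The joint distribution `p` of `n` variables arises from a network of shape `G_{n,m}` in `T`. -/
def CompatibleWithGBN (T : CausalOPT C) {n : ℕ} (m : ℕ) {V : Fin n → Type} [∀ i, Fintype (V i)]
    (p : PMF (∀ i, V i)) : Prop :=
  ∃ G : GBN T n m V, ∀ x, (p x).toReal = T.prob (G.circuit x)

end GBN

/-! ### Entropies -/

/-- Shannon entropy in bits. -/
def shannonEntropy {α : Type} [Fintype α] (p : PMF α) : ℝ :=
  -∑ a, (p a).toReal * Real.logb 2 (p a).toReal

section Entropy

variable {n : ℕ} {V : Fin n → Type} [∀ i, Fintype (V i)]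

/-- The entropy `H(V_i)` of the `i`-th of jointly distributed variables. -/
def entropyVar (p : PMF (∀ i, V i)) (i : Fin n) : ℝ :=
  shannonEntropy (p.map (fun x => x i))

/-- The mutual information `I(V_i : V_j) = H(V_i) + H(V_j) - H(V_i, V_j)`. -/
def mutualInfo (p : PMF (∀ i, V i)) (i j : Fin n) : ℝ :=
  entropyVar p i + entropyVar p j - shannonEntropy (p.map (fun x => (x i, x j)))

/-- The inequality for the `m + 1` variables `W_{k+1} = V_{f k}`, `k = 0, …, m`:
`∑_{k=2}^{m+1} I(W_1 : W_k) ≤ ∑_{k=0}^{m-2} (m-k-1) (m-k-1)! / (m-1)! * H(W_{k+1})`. -/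
def CommonAncestorInequality (m : ℕ) (p : PMF (∀ i, V i)) (f : Fin (m + 1) → Fin n) : Prop :=
  ∑ k : Fin m, mutualInfo p (f 0) (f k.succ) ≤
    ∑ k : Fin (m - 1),
      (((m - k - 1 : ℕ) : ℝ) * (Nat.factorial (m - k - 1) : ℝ) / (Nat.factorial (m - 1) : ℝ)) *
        entropyVar p (f ⟨k, by omega⟩)

end Entropy

/-- The joint distribution of `n` perfectly correlated copies of one fair coin. -/
def coinCopies (n : ℕ) : PMF (Fin n → Bool) :=
  (PMF.uniformOfFintype Bool).map (fun b _ => b)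

end

noncomputable section

/-! ### Shannon inequalities for functions of one random point. -/

section EntropyInequalities

variable {Ω α β γ : Type} [Fintype Ω]

/-! Call a source decorrelated when its preparation is replaced by the product of its single-party
marginals. By causality, two parties see of each source only what it sends to them. Decorrelating
sources that miss at least one of the two therefore leaves their joint distribution unchanged
(`networkDist_decorrelateOn_map_pair`). In particular no single-party law ever changes.

Write the variables as W_0, …, W_m, and let P_d be the distribution after decorrelating every source
that misses one of W_0, …, W_{d-1}. P_d and P_{d+1} differ only in sources missing W_d, so they
agree on every pair containing W_d. The triangle inequality in P_{d+1} then bounds I(W_d : W_{d+1})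
+ I(W_d : W_k), which may be computed in P_d, by H(W_d) + I(W_{d+1} : W_k). In P_{m-1} a source
still correlated reaches W_0, …, W_{m-2}; it cannot also reach both W_{m-1} and W_m, since it has
only m legs. Hence these two are independent. `sum_le_of_recursion` assembles these bounds.

For copies of a fair coin every entropy and mutual information is 1, so the left side is m while the
right side telescopes to m - 1/(m-1)!. -/

theorem PMF.sum_toReal (p : PMF Ω) : ∑ ω, (p ω).toReal = 1 := by
  rw [← ENNReal.toReal_sum fun a _ => p.apply_ne_top a, ← tsum_fintype (L := .unconditional Ω),
    p.tsum_coe, ENNReal.toReal_one]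

theorem PMF.toReal_map_apply (p : PMF Ω) (g : Ω → α) (a : α) [DecidablePred fun ω => g ω = a] :
    (p.map g a).toReal = ∑ ω with g ω = a, (p ω).toReal := by
  classical
  rw [PMF.map_apply, tsum_fintype, ENNReal.toReal_sum]
  · rw [Finset.sum_filter]
    refine Finset.sum_congr rfl fun ω _ => ?_
    by_cases h : g ω = a
    · simp [h]
    · simp [h, Ne.symm h]
  · intro ω _
    split_ifs
    · exact p.apply_ne_top ω
    · exact ENNReal.zero_ne_top

theorem PMF.sum_map_mul [Fintype α] (p : PMF Ω) (g : Ω → α) (F : α → ℝ) :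
    ∑ a, (p.map g a).toReal * F a = ∑ ω, (p ω).toReal * F (g ω) := by
  classical
  simp_rw [PMF.toReal_map_apply, Finset.sum_mul]
  rw [← Finset.sum_fiberwise (s := Finset.univ) (g := g)]
  refine Finset.sum_congr rfl fun a _ => Finset.sum_congr rfl fun ω hω => ?_
  rw [(Finset.mem_filter.mp hω).2]

/-- Writing every entropy as an average over the same space `Ω` lets entropies of different
variables be compared pointwise. -/
theorem shannonEntropy_map [Fintype α] (p : PMF Ω) (g : Ω → α) :
    shannonEntropy (p.map g) =
      -∑ ω, (p ω).toReal * Real.logb 2 (p.map g (g ω)).toReal := by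
  rw [shannonEntropy, PMF.sum_map_mul p g fun a => Real.logb 2 (p.map g a).toReal]

theorem PMF.toReal_map_pos (p : PMF Ω) (g : Ω → α) {ω : Ω} (h : (p ω).toReal ≠ 0) :
    0 < (p.map g (g ω)).toReal := by
  classical
  rw [PMF.toReal_map_apply]
  have h' : 0 < (p ω).toReal := lt_of_le_of_ne ENNReal.toReal_nonneg h.symm
  exact lt_of_lt_of_le h' (Finset.single_le_sum (f := fun ω => (p ω).toReal)
    (fun i _ => ENNReal.toReal_nonneg) (Finset.mem_filter.mpr ⟨Finset.mem_univ _, rfl⟩))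

/-- A value of a variable is at most as likely as its image under a function. -/
theorem PMF.toReal_map_le (p : PMF Ω) (g : Ω → α) (h : α → β) (a : α) :
    (p.map g a).toReal ≤ (p.map (h ∘ g) (h a)).toReal := by
  classical
  simp_rw [PMF.toReal_map_apply]
  refine Finset.sum_le_sum_of_subset_of_nonneg ?_ fun _ _ _ => ENNReal.toReal_nonneg
  intro ω
  simp only [Finset.mem_filter, Finset.mem_univ, true_and, Function.comp_apply]
  exact congrArg h

/-- Entropy does not increase under functions. -/
theorem shannonEntropy_map_comp_le [Fintype α] [Fintype β] (p : PMF Ω) (g : Ω → α) (h : α → β) :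
    shannonEntropy (p.map (h ∘ g)) ≤ shannonEntropy (p.map g) := by
  rw [shannonEntropy_map, shannonEntropy_map, neg_le_neg_iff]
  refine Finset.sum_le_sum fun ω _ => ?_
  by_cases h0 : (p ω).toReal = 0
  · simp [h0]
  · exact mul_le_mul_of_nonneg_left (Real.logb_le_logb_of_le one_lt_two
      (p.toReal_map_pos g h0) (p.toReal_map_le g h _)) ENNReal.toReal_nonneg

theorem PMF.sum_map_pair_snd [Fintype β] (p : PMF Ω) (X : Ω → α) (Y : Ω → β) (a : α) :
    ∑ b, (p.map (fun ω => (X ω, Y ω)) (a, b)).toReal = (p.map X a).toReal := by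
  classical
  simp_rw [PMF.toReal_map_apply, Prod.mk.injEq, ← Finset.filter_filter]
  exact Finset.sum_fiberwise _ _ _

/-- The entropic triangle inequality `H(X) + H(Y, Z) ≤ H(X, Y) + H(X, Z)`. -/
theorem shannonEntropy_triangle [Fintype α] [Fintype β] [Fintype γ] (p : PMF Ω) (X : Ω → α) (Y : Ω → β) (Z : Ω → γ) :
    shannonEntropy (p.map X) + shannonEntropy (p.map fun ω => (Y ω, Z ω)) ≤
      shannonEntropy (p.map fun ω => (X ω, Y ω)) + shannonEntropy (p.map fun ω => (X ω, Z ω)) := by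
  set PX := fun a => (p.map X a).toReal with hPX
  set PYZ := fun a => (p.map (fun ω => (Y ω, Z ω)) a).toReal with hPYZ
  set PXY := fun a => (p.map (fun ω => (X ω, Y ω)) a).toReal with hPXY
  set PXZ := fun a => (p.map (fun ω => (X ω, Z ω)) a).toReal with hPXZ
  set P := fun a => (p.map (fun ω => (X ω, Y ω, Z ω)) a).toReal with hP
  -- `F` is the ratio whose expected logarithm is the difference of the two sides. Its mean is at
  -- most 1, and log x ≤ x - 1 concludes.
  let F : α × β × γ → ℝ := fun t =>
    PXY (t.1, t.2.1) * PXZ (t.1, t.2.2) / (PX t.1 * PYZ t.2)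
  have hF : ∑ ω, (p ω).toReal * F (X ω, Y ω, Z ω) ≤ 1 := by
    rw [← PMF.sum_map_mul p (fun ω => (X ω, Y ω, Z ω)) F]
    calc ∑ t, P t * F t ≤ ∑ t : α × β × γ, PXY (t.1, t.2.1) * PXZ (t.1, t.2.2) / PX t.1 := by
          refine Finset.sum_le_sum fun t _ => ?_
          have hle : P t ≤ PYZ t.2 := p.toReal_map_le (fun ω => (X ω, Y ω, Z ω)) Prod.snd t
          have h0 : 0 ≤ PXY (t.1, t.2.1) * PXZ (t.1, t.2.2) / PX t.1 := by positivity
          have h1 : P t * F t =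
              (PXY (t.1, t.2.1) * PXZ (t.1, t.2.2) / PX t.1) * (P t / PYZ t.2) := by
            simp only [F, div_eq_mul_inv, mul_inv]; ring
          rw [h1]
          -- This covers a vanishing denominator too, since 0 / 0 = 0.
          exact mul_le_of_le_one_right h0 (div_le_one_of_le₀ hle ENNReal.toReal_nonneg)
      _ = ∑ a, (∑ b, PXY (a, b)) * (∑ c, PXZ (a, c)) / PX a := by
          rw [Fintype.sum_prod_type]
          refine Finset.sum_congr rfl fun a _ => ?_
          rw [Fintype.sum_prod_type, Finset.sum_mul_sum, Finset.sum_div]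
          refine Finset.sum_congr rfl fun b _ => ?_
          rw [Finset.sum_div]
      _ = ∑ a, PX a := by
          refine Finset.sum_congr rfl fun a _ => ?_
          rw [PMF.sum_map_pair_snd, PMF.sum_map_pair_snd]
          exact mul_self_div_self _
      _ = 1 := PMF.sum_toReal _
  have key : ∑ ω, (p ω).toReal * (Real.logb 2 (PXY (X ω, Y ω)) + Real.logb 2 (PXZ (X ω, Z ω)) -
      (Real.logb 2 (PX (X ω)) + Real.logb 2 (PYZ (Y ω, Z ω)))) ≤ 0 := by
    have hterm : ∀ ω, (p ω).toReal * (Real.logb 2 (PXY (X ω, Y ω)) +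
        Real.logb 2 (PXZ (X ω, Z ω)) -
        (Real.logb 2 (PX (X ω)) + Real.logb 2 (PYZ (Y ω, Z ω)))) ≤
        ((p ω).toReal * F (X ω, Y ω, Z ω) - (p ω).toReal) / Real.log 2 := by
      intro ω
      by_cases h0 : (p ω).toReal = 0
      · simp [h0]
      have h1 : 0 < PX (X ω) := p.toReal_map_pos X h0
      have h2 : 0 < PYZ (Y ω, Z ω) := p.toReal_map_pos (fun ω => (Y ω, Z ω)) h0
      have h3 : 0 < PXY (X ω, Y ω) := p.toReal_map_pos (fun ω => (X ω, Y ω)) h0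
      have h4 : 0 < PXZ (X ω, Z ω) := p.toReal_map_pos (fun ω => (X ω, Z ω)) h0
      rw [← Real.logb_mul h3.ne' h4.ne', ← Real.logb_mul h1.ne' h2.ne',
        ← Real.logb_div (by positivity) (by positivity), ← mul_sub_one,
        mul_div_assoc (p ω).toReal]
      refine mul_le_mul_of_nonneg_left ?_ ENNReal.toReal_nonneg
      exact div_le_div_of_nonneg_right (Real.log_le_sub_one_of_pos (by positivity))
        (Real.log_nonneg one_le_two)
    refine (Finset.sum_le_sum fun ω _ => hterm ω).trans ?_
    rw [← Finset.sum_div, Finset.sum_sub_distrib, PMF.sum_toReal]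
    exact div_nonpos_of_nonpos_of_nonneg (by linarith) (Real.log_nonneg one_le_two)
  simp only [shannonEntropy_map p X, shannonEntropy_map p fun ω => (Y ω, Z ω),
    shannonEntropy_map p fun ω => (X ω, Y ω), shannonEntropy_map p fun ω => (X ω, Z ω)]
  simp only [mul_sub, mul_add, Finset.sum_sub_distrib, Finset.sum_add_distrib] at key
  linarith

/-- Entropy is additive on independent variables. -/
theorem shannonEntropy_map_pair_of_indep [Fintype α] [Fintype β] (p : PMF Ω) (X : Ω → α) (Y : Ω → β)
    (h : ∀ ω, (p.map (fun ω => (X ω, Y ω)) (X ω, Y ω)).toReal =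
      (p.map X (X ω)).toReal * (p.map Y (Y ω)).toReal) :
    shannonEntropy (p.map fun ω => (X ω, Y ω)) =
      shannonEntropy (p.map X) + shannonEntropy (p.map Y) := by
  simp only [shannonEntropy_map p X, shannonEntropy_map p Y,
    shannonEntropy_map p fun ω => (X ω, Y ω)]
  rw [← neg_add, ← Finset.sum_add_distrib]
  congr 1
  refine Finset.sum_congr rfl fun ω _ => ?_
  by_cases h0 : (p ω).toReal = 0
  · simp [h0]
  rw [h, Real.logb_mul (p.toReal_map_pos X h0).ne' (p.toReal_map_pos Y h0).ne', mul_add]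

theorem shannonEntropy_map_coin [Fintype α] (g : Bool → α) (hg : Function.Injective g) :
    shannonEntropy ((PMF.uniformOfFintype Bool).map g) = 1 := by
  classical
  have h : ∀ b, ((PMF.uniformOfFintype Bool).map g (g b)).toReal = 1 / 2 := by
    intro b
    rw [PMF.toReal_map_apply]
    have : (Finset.univ.filter fun ω => g ω = g b) = {b} := by
      ext; simp [hg.eq_iff]
    rw [this]
    simp
  rw [shannonEntropy_map]
  simp only [h]
  rw [← Finset.sum_mul, PMF.sum_toReal, one_div, Real.logb_inv, Real.logb_self_eq_one one_lt_two]
  norm_num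

end EntropyInequalities

/-! ### Mutual information, the values for coins, and the numerical recursion. -/

section MutualInformation

variable {n : ℕ} {V : Fin n → Type} [∀ i, Fintype (V i)]

theorem mutualInfo_le_entropyVar (p : PMF (∀ i, V i)) (i j : Fin n) :
    mutualInfo p i j ≤ entropyVar p i := by
  have := shannonEntropy_map_comp_le p (fun x => (x i, x j)) Prod.snd
  change shannonEntropy (p.map fun x => x j) ≤ _ at this
  simp only [mutualInfo, entropyVar]
  linarith

/-- The triangle inequality with H(V_j) + H(V_k) added to both sides. -/
theorem mutualInfo_add_le (p : PMF (∀ i, V i)) (i j k : Fin n) :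
    mutualInfo p i j + mutualInfo p i k ≤ entropyVar p i + mutualInfo p j k := by
  have := shannonEntropy_triangle p (fun x => x i) (fun x => x j) (fun x => x k)
  simp only [mutualInfo, entropyVar]
  linarith

theorem mutualInfo_eq_zero_of_indep (p : PMF (∀ i, V i)) (i j : Fin n)
    (h : ∀ x : ∀ i, V i, (p.map (fun x => (x i, x j)) (x i, x j)).toReal =
      (p.map (fun x => x i) (x i)).toReal * (p.map (fun x => x j) (x j)).toReal) :
    mutualInfo p i j = 0 := by
  rw [mutualInfo, entropyVar, entropyVar, sub_eq_zero]
  exact (shannonEntropy_map_pair_of_indep p (fun x => x i) (fun x => x j) h).symm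

theorem entropyVar_congr {p q : PMF (∀ i, V i)} {i : Fin n}
    (h : p.map (fun x => x i) = q.map (fun x => x i)) : entropyVar p i = entropyVar q i := by
  rw [entropyVar, entropyVar, h]

theorem mutualInfo_congr {p q : PMF (∀ i, V i)} {i j : Fin n}
    (h : p.map (fun x => (x i, x j)) = q.map (fun x => (x i, x j))) :
    mutualInfo p i j = mutualInfo q i j := by
  have h1 := congrArg (PMF.map Prod.fst) h
  have h2 := congrArg (PMF.map Prod.snd) h
  simp only [PMF.map_comp] at h1 h2
  rw [mutualInfo, mutualInfo, h, entropyVar_congr h1, entropyVar_congr h2]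

theorem entropyVar_coinCopies (n : ℕ) (i : Fin n) : entropyVar (coinCopies n) i = 1 := by
  rw [entropyVar, coinCopies, PMF.map_comp]
  exact shannonEntropy_map_coin _ fun _ _ h => h

theorem mutualInfo_coinCopies (n : ℕ) (i j : Fin n) : mutualInfo (coinCopies n) i j = 1 := by
  rw [mutualInfo, entropyVar_coinCopies, entropyVar_coinCopies, coinCopies, PMF.map_comp,
    shannonEntropy_map_coin ((fun x : Fin n → Bool => (x i, x j)) ∘ fun b _ => b)
      fun _ _ h => (Prod.mk.inj h).1]
  norm_num

/-- Telescoping: j · j! = (j+1)! - j!. -/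
theorem sum_range_mul_factorial (M : ℕ) :
    ∑ k ∈ Finset.range M, ((M - k : ℕ) : ℝ) * (Nat.factorial (M - k) : ℝ) =
      (Nat.factorial (M + 1) : ℝ) - 1 := by
  induction M with
  | zero => simp
  | succ M ih =>
    rw [Finset.sum_range_succ']
    simp only [Nat.add_sub_add_right, ih, Nat.sub_zero, Nat.factorial_succ (M + 1)]
    push_cast
    ring

theorem not_commonAncestorInequality_coinCopies {m : ℕ} (hm : 1 ≤ m) {n : ℕ}
    (f : Fin (m + 1) → Fin n) : ¬ CommonAncestorInequality m (coinCopies n) f := by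
  obtain ⟨M, rfl⟩ : ∃ M, m = M + 1 := ⟨m - 1, by omega⟩
  rw [CommonAncestorInequality]
  simp only [mutualInfo_coinCopies, entropyVar_coinCopies, mul_one, Finset.sum_const,
    Finset.card_univ, Fintype.card_fin, nsmul_eq_mul, not_le]
  rw [← Finset.sum_div, Nat.add_sub_cancel, div_lt_iff₀ (by positivity)]
  have h := Finset.sum_range (n := M)
    (fun k => ((M - k : ℕ) : ℝ) * (Nat.factorial (M - k) : ℝ))
  rw [sum_range_mul_factorial] at h
  have e : ∀ k : ℕ, M + 1 - k - 1 = M - k := fun k => by omega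
  simp only [e, ← h, Nat.factorial_succ]
  push_cast
  linarith

/-- The recursion behind the common ancestor inequality. -/
theorem sum_le_of_recursion (m : ℕ) (H : ℕ → ℝ) (I : ℕ → ℕ → ℝ)
    (hle : ∀ d k, d < k → k ≤ m → I d k ≤ H d)
    (hrec : ∀ d k, d + 1 < k → k ≤ m → I d (d + 1) + I d k ≤ H d + I (d + 1) k)
    (hlast : ∀ d, d + 1 = m → I d (d + 1) ≤ 0) (M : ℕ) :
    ∀ d, d + (M + 1) = m →
      ∑ k ∈ Finset.range (M + 1), I d (d + 1 + k) ≤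
        ∑ k ∈ Finset.range M,
          (((M - k : ℕ) : ℝ) * (Nat.factorial (M - k) : ℝ) / (Nat.factorial M : ℝ)) * H (d + k) := by
  induction M with
  | zero =>
    intro d hd
    simpa using hlast d hd
  | succ M ih =>
    intro d hd
    have h0 := ih (d + 1) (by omega)
    -- `hrec` summed over the M + 1 indices beyond d + 1, so that I d (d+1) appears M + 1 times but
    -- each other term once.
    have h1 : ∑ k ∈ Finset.range (M + 1), (I d (d + 1) + I d (d + 1 + (k + 1))) ≤
        ∑ k ∈ Finset.range (M + 1), (H d + I (d + 1) (d + 1 + 1 + k)) := by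
      refine Finset.sum_le_sum fun k hk => ?_
      have hk := Finset.mem_range.mp hk
      have := hrec d (d + 1 + 1 + k) (by omega) (by omega)
      rwa [show d + 1 + (k + 1) = d + 1 + 1 + k by omega]
    have h2 : ∑ k ∈ Finset.range (M + 1), I d (d + 1 + (k + 1)) ≤
        ∑ k ∈ Finset.range (M + 1), H d := by
      refine Finset.sum_le_sum fun k hk => ?_
      have hk := Finset.mem_range.mp hk
      exact hle d _ (by omega) (by omega)
    have h3 : ∑ k ∈ Finset.range M, (((M + 1 - (k + 1) : ℕ) : ℝ) *
          (Nat.factorial (M + 1 - (k + 1)) : ℝ) / (Nat.factorial (M + 1) : ℝ)) * H (d + (k + 1)) =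
        (∑ k ∈ Finset.range M, (((M - k : ℕ) : ℝ) * (Nat.factorial (M - k) : ℝ) /
          (Nat.factorial M : ℝ)) * H (d + 1 + k)) / (M + 1) := by
      rw [Finset.sum_div]
      refine Finset.sum_congr rfl fun k _ => ?_
      rw [Nat.add_sub_add_right, Nat.factorial_succ, show d + (k + 1) = d + 1 + k by omega]
      have : (Nat.factorial M : ℝ) ≠ 0 := by positivity
      have : (M + 1 : ℝ) ≠ 0 := by positivity
      push_cast
      field_simp
    rw [Finset.sum_range_succ' _ M, Finset.sum_range_succ' _ (M + 1), h3]
    simp only [Finset.sum_add_distrib, Finset.sum_const, Finset.card_range, nsmul_eq_mul,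
      Nat.sub_zero, add_zero] at h1 h2 ⊢
    set A := ∑ k ∈ Finset.range (M + 1), I d (d + 1 + (k + 1))
    set B := ∑ k ∈ Finset.range (M + 1), I (d + 1) (d + 1 + 1 + k)
    set R := ∑ k ∈ Finset.range M, (((M - k : ℕ) : ℝ) * (Nat.factorial (M - k) : ℝ) /
          (Nat.factorial M : ℝ)) * H (d + 1 + k)
    have hf : (Nat.factorial (M + 1) : ℝ) ≠ 0 := by positivity
    rw [mul_div_assoc, div_self hf, mul_one]
    have hM : (0 : ℝ) < M + 1 := by positivity
    refine le_of_mul_le_mul_left ?_ hM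
    rw [mul_add, mul_add, mul_div_cancel₀ _ hM.ne']
    push_cast at h1 h2 ⊢
    -- Multiplying the goal by M + 1 calls for M further copies of `A`, which `hle` bounds. `H d`
    -- then has total weight (M+1)², and dividing back leaves M + 1 for `H d` and 1/(M+1) for the
    -- earlier bound.
    have h4 : (M : ℝ) * A ≤ M * ((M + 1) * H d) := mul_le_mul_of_nonneg_left h2 (by positivity)
    linarith

end MutualInformation
end

noncomputable section

/-! ### Rewiring of product states, effects and joint preparations. -/

section Wiring

variable {C : Type u} [Category.{v} C] [MonoidalCategory C]

/-- The parallel composition of the events `f 0, f 1, …`. -/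
def mapFin : (n : ℕ) → (A B : Fin n → C) → (∀ i, A i ⟶ B i) → (tensorFin n A ⟶ tensorFin n B)
  | 0, _, _, _ => 𝟙 (𝟙_ C)
  | n + 1, A, B, f =>
      f 0 ⊗ₘ mapFin n (fun i => A i.succ) (fun i => B i.succ) (fun i => f i.succ)

/-- The parallel composition of the states `τ 0, τ 1, …`. -/
def productState (n : ℕ) (A : Fin n → C) (τ : ∀ i, 𝟙_ C ⟶ A i) : 𝟙_ C ⟶ tensorFin n A :=
  unitFin n ≫ mapFin n _ A τ

theorem mapFin_id : ∀ (n : ℕ) (A : Fin n → C), mapFin n A A (fun i => 𝟙 (A i)) = 𝟙 _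
  | 0, _ => rfl
  | n + 1, A =>
      (congrArg (𝟙 (A 0) ⊗ₘ ·) (mapFin_id n fun i => A i.succ)).trans (id_tensorHom_id _ _)

theorem mapFin_comp : ∀ (n : ℕ) (A B D : Fin n → C) (f : ∀ i, A i ⟶ B i) (g : ∀ i, B i ⟶ D i),
    mapFin n A B f ≫ mapFin n B D g = mapFin n A D (fun i => f i ≫ g i)
  | 0, _, _, _, _, _ => Category.id_comp _
  | n + 1, _, _, _, f, g =>
      (tensorHom_comp_tensorHom _ _ _ _).trans
        (congrArg (f 0 ≫ g 0 ⊗ₘ ·) (mapFin_comp n _ _ _ (fun i => f i.succ) fun i => g i.succ))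

theorem mapFin_effectFin : ∀ (n : ℕ) (A B : Fin n → C) (f : ∀ i, A i ⟶ B i)
    (e : ∀ i, B i ⟶ 𝟙_ C), mapFin n A B f ≫ effectFin n B e = effectFin n A (fun i => f i ≫ e i)
  | 0, _, _, _, _ => Category.id_comp _
  | n + 1, _, _, f, e =>
      (tensorHom_comp_tensorHom_assoc _ _ _ _ _).trans
        (congrArg (fun h => (f 0 ≫ e 0 ⊗ₘ h) ≫ (λ_ (𝟙_ C)).hom)
          (mapFin_effectFin n _ _ (fun i => f i.succ) fun i => e i.succ))

theorem productState_mapFin (n : ℕ) (A B : Fin n → C) (τ : ∀ i, 𝟙_ C ⟶ A i)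
    (f : ∀ i, A i ⟶ B i) :
    productState n A τ ≫ mapFin n A B f = productState n B (fun i => τ i ≫ f i) := by
  rw [productState, Category.assoc, mapFin_comp, productState]

theorem leftUnitor_inv_whiskerLeft_tensorHom {X Y Z : C} (U : 𝟙_ C ⟶ X) (f : 𝟙_ C ⟶ Y)
    (g : X ⟶ Z) :
    ((λ_ (𝟙_ C)).inv ≫ (𝟙_ C ◁ U)) ≫ (f ⊗ₘ g) = (λ_ (𝟙_ C)).inv ≫ (f ⊗ₘ U ≫ g) := by
  rw [Category.assoc, ← id_tensorHom, tensorHom_comp_tensorHom, Category.id_comp]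

theorem productState_succ (n : ℕ) (A : Fin (n + 1) → C) (τ : ∀ i, 𝟙_ C ⟶ A i) :
    productState (n + 1) A τ = (λ_ (𝟙_ C)).inv ≫
      (τ 0 ⊗ₘ productState n (fun i => A i.succ) (fun i => τ i.succ)) :=
  leftUnitor_inv_whiskerLeft_tensorHom _ _ _

/-- The Eckmann–Hilton argument: parallel scalars compose sequentially, so `prob_comp` also covers
independent circuits. -/
theorem leftUnitor_inv_tensorHom_leftUnitor {X Y : C} (a : 𝟙_ C ⟶ X) (b : 𝟙_ C ⟶ Y)
    (c : X ⟶ 𝟙_ C) (d : Y ⟶ 𝟙_ C) :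
    ((λ_ (𝟙_ C)).inv ≫ (a ⊗ₘ b)) ≫ (c ⊗ₘ d) ≫ (λ_ (𝟙_ C)).hom = (a ≫ c) ≫ b ≫ d := by
  rw [Category.assoc, tensorHom_comp_tensorHom_assoc, MonoidalCategory.tensorHom_def,
    Category.assoc, leftUnitor_naturality, unitors_equal,
    rightUnitor_naturality_assoc, ← unitors_equal, Iso.inv_hom_id_assoc]

theorem productState_effectFin_succ (n : ℕ) (A : Fin (n + 1) → C) (τ : ∀ i, 𝟙_ C ⟶ A i)
    (e : ∀ i, A i ⟶ 𝟙_ C) :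
    productState (n + 1) A τ ≫ effectFin (n + 1) A e = (τ 0 ≫ e 0) ≫
      productState n _ (fun i => τ i.succ) ≫ effectFin n _ (fun i => e i.succ) :=
  (congrArg (· ≫ effectFin (n + 1) A e) (productState_succ n A τ)).trans
    (leftUnitor_inv_tensorHom_leftUnitor _ _ _ _)

theorem effectFin_unitFin : ∀ n : ℕ,
    effectFin n (fun _ => 𝟙_ C) (fun _ => 𝟙 (𝟙_ C)) ≫ unitFin n = 𝟙 _
  | 0 => Category.id_comp _
  | n + 1 => by
    have key : ∀ {X : C} (e : X ⟶ 𝟙_ C) (U : 𝟙_ C ⟶ X), e ≫ U = 𝟙 X →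
        ((𝟙 (𝟙_ C) ⊗ₘ e) ≫ (λ_ (𝟙_ C)).hom) ≫ (λ_ (𝟙_ C)).inv ≫ (𝟙_ C ◁ U) = 𝟙 _ := by
      intro X e U h
      rw [Category.assoc, Iso.hom_inv_id_assoc, id_tensorHom, ← MonoidalCategory.whiskerLeft_comp,
        h, MonoidalCategory.whiskerLeft_id]
    exact key _ _ (effectFin_unitFin n)

/-- The inductive step for joint preparations, with arbitrary objects in place of the unfolded
tensor products. -/
theorem leftUnitor_inv_comp_naturality {X Y X' Y' Z Z' : C} (σ : 𝟙_ C ⟶ X) (J : 𝟙_ C ⟶ Y)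
    (z : X ⊗ Y ⟶ Z) (z' : X' ⊗ Y' ⟶ Z') (k : Z ⟶ Z') (f : X ⟶ X') (g : Y ⟶ Y')
    {σ' : 𝟙_ C ⟶ X'} {J' : 𝟙_ C ⟶ Y'} (hσ : σ ≫ f = σ') (hJ : J ≫ g = J')
    (h : (f ⊗ₘ g) ≫ z' = z ≫ k) :
    ((λ_ (𝟙_ C)).inv ≫ (σ ⊗ₘ J) ≫ z) ≫ k = (λ_ (𝟙_ C)).inv ≫ (σ' ⊗ₘ J') ≫ z' := by
  rw [Category.assoc, Category.assoc, ← h, tensorHom_comp_tensorHom_assoc, hσ, hJ]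

variable [SymmetricCategory C]

theorem tensorμ_whiskerLeft_naturality {X₀ X Y₀ Y X₀' X' Y₀' Y' Z Z' : C} (f₀ : X₀ ⟶ X₀')
    (f : X ⟶ X') (g₀ : Y₀ ⟶ Y₀') (g : Y ⟶ Y') (z : X ⊗ Y ⟶ Z) (z' : X' ⊗ Y' ⟶ Z') (k : Z ⟶ Z')
    (h : (f ⊗ₘ g) ≫ z' = z ≫ k) :
    ((f₀ ⊗ₘ f) ⊗ₘ (g₀ ⊗ₘ g)) ≫ tensorμ X₀' X' Y₀' Y' ≫ ((X₀' ⊗ Y₀') ◁ z') =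
      (tensorμ X₀ X Y₀ Y ≫ ((X₀ ⊗ Y₀) ◁ z)) ≫ ((f₀ ⊗ₘ g₀) ⊗ₘ k) := by
  rw [tensorμ_natural_assoc, Category.assoc, ← id_tensorHom, ← id_tensorHom,
    tensorHom_comp_tensorHom, tensorHom_comp_tensorHom, h, Category.id_comp, Category.comp_id]

theorem zipFin_naturality : ∀ (n : ℕ) (A B A' B' : Fin n → C)
    (f : ∀ i, A i ⟶ A' i) (g : ∀ i, B i ⟶ B' i),
    (mapFin n A A' f ⊗ₘ mapFin n B B' g) ≫ zipFin n A' B' =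
      zipFin n A B ≫ mapFin n _ _ (fun i => f i ⊗ₘ g i)
  | 0, _, _, _, _, _, _ =>
      ((congrArg (· ≫ (λ_ (𝟙_ C)).hom) (id_tensorHom_id _ _)).trans (Category.id_comp _)).trans
        (Category.comp_id _).symm
  | n + 1, _, _, _, _, f, g =>
      tensorμ_whiskerLeft_naturality _ _ _ _ _ _ _
        (zipFin_naturality n _ _ _ _ (fun i => f i.succ) fun i => g i.succ)

/-- Local operations that act separately on the system from each source can be moved back into the
sources. -/
theorem jointPreparation_mapFin (n : ℕ) : ∀ (N : ℕ) (A B : Fin N → Fin n → C)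
    (σ : ∀ s, 𝟙_ C ⟶ tensorFin n (A s)) (D : ∀ s i, A s i ⟶ B s i),
    jointPreparation n N A σ ≫
        mapFin n _ _ (fun i => mapFin N (fun s => A s i) (fun s => B s i) (fun s => D s i)) =
      jointPreparation n N B (fun s => σ s ≫ mapFin n (A s) (B s) (D s))
  | 0, _, _, _, _ =>
      (congrArg (unitFin n ≫ ·) (mapFin_id n fun _ => 𝟙_ C)).trans (Category.comp_id _)
  | N + 1, _, _, σ, D =>
      leftUnitor_inv_comp_naturality (σ 0) _ _ _ _ _ _ rfl
        (jointPreparation_mapFin n N _ _ (fun s => σ s.succ) fun s => D s.succ)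
        (zipFin_naturality n _ _ _ _ _ _)

/-- Naturality moves `U` past the interchange, which then acts on trivial systems only and is
absorbed by unitors. -/
theorem leftUnitor_inv_tensorμ_unit {X Z : C} (U : 𝟙_ C ⟶ X) (z : X ⊗ X ⟶ Z) (k : X ⟶ Z)
    (h : (λ_ (𝟙_ C)).inv ≫ (U ⊗ₘ U) ≫ z = U ≫ k) :
    (λ_ (𝟙_ C)).inv ≫ (((λ_ (𝟙_ C)).inv ≫ (𝟙_ C ◁ U)) ⊗ₘ ((λ_ (𝟙_ C)).inv ≫ (𝟙_ C ◁ U))) ≫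
        tensorμ (𝟙_ C) X (𝟙_ C) X ≫ ((𝟙_ C ⊗ 𝟙_ C) ◁ z) =
      ((λ_ (𝟙_ C)).inv ≫ (𝟙_ C ◁ U)) ≫ ((λ_ (𝟙_ C)).inv ⊗ₘ k) := by
  have h1 : ((λ_ (𝟙_ C)).inv ▷ (𝟙_ C ⊗ 𝟙_ C)) ≫ tensorμ (𝟙_ C) (𝟙_ C) (𝟙_ C) (𝟙_ C) =
      (λ_ (𝟙_ C ⊗ 𝟙_ C)).hom ≫ ((λ_ (𝟙_ C)).inv ⊗ₘ (λ_ (𝟙_ C)).inv) := by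
    rw [tensor_left_unitality, Category.assoc, Category.assoc, tensorHom_comp_tensorHom]
    simp
  have h2 : (λ_ (𝟙_ C)).inv ≫ ((λ_ (𝟙_ C)).inv ⊗ₘ (λ_ (𝟙_ C)).inv) ≫
      tensorμ (𝟙_ C) (𝟙_ C) (𝟙_ C) (𝟙_ C) =
      (λ_ (𝟙_ C)).inv ≫ ((λ_ (𝟙_ C)).inv ⊗ₘ (λ_ (𝟙_ C)).inv) := by
    rw [tensorHom_def', Category.assoc, h1, leftUnitor_naturality_assoc, tensorHom_def',
      Iso.inv_hom_id_assoc]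
  rw [← tensorHom_comp_tensorHom_assoc, ← id_tensorHom (𝟙_ C) U, tensorμ_natural_assoc,
    reassoc_of% h2, ← id_tensorHom, id_tensorHom_id, tensorHom_comp_tensorHom,
    tensorHom_comp_tensorHom, Category.id_comp, Category.assoc, tensorHom_comp_tensorHom, ← h]
  simp

theorem zipFin_unitFin : ∀ n : ℕ, (λ_ (𝟙_ C)).inv ≫ (unitFin n ⊗ₘ unitFin n) ≫
      zipFin n (fun _ => 𝟙_ C) (fun _ => 𝟙_ C) =
      unitFin n ≫ mapFin n _ _ (fun _ => (λ_ (𝟙_ C)).inv)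
  | 0 => by
    change (λ_ (𝟙_ C)).inv ≫ (𝟙 (𝟙_ C) ⊗ₘ 𝟙 (𝟙_ C)) ≫ (λ_ (𝟙_ C)).hom = 𝟙 (𝟙_ C) ≫ 𝟙 (𝟙_ C)
    simp
  | n + 1 => leftUnitor_inv_tensorμ_unit _ _ _ (zipFin_unitFin n)

/-- Independent sources of independent systems prepare independent systems. -/
theorem jointPreparation_productState (n : ℕ) :
    ∀ (N : ℕ) (A : Fin N → Fin n → C) (τ : ∀ s i, 𝟙_ C ⟶ A s i),
    jointPreparation n N A (fun s => productState n (A s) (τ s)) =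
      productState n _ (fun i => productState N (fun s => A s i) (fun s => τ s i))
  | 0, A, τ => by
    refine ((congrArg (unitFin n ≫ ·) (?_ : mapFin n _ _ _ = _)).trans (Category.comp_id _)).symm
    refine Eq.trans (congrArg (mapFin n (fun _ => 𝟙_ C) fun _ => 𝟙_ C) ?_)
      (mapFin_id n fun _ => 𝟙_ C)
    exact funext fun _ => Category.comp_id _
  | N + 1, A, τ => by
    have h1 : jointPreparation n (N + 1) A (fun s => productState n (A s) (τ s)) =
        ((λ_ (𝟙_ C)).inv ≫ (unitFin n ⊗ₘ unitFin n) ≫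
          zipFin n (fun _ => 𝟙_ C) (fun _ => 𝟙_ C)) ≫
        mapFin n _ _ (fun i => τ 0 i ⊗ₘ
          productState N (fun s => A s.succ i) (fun s => τ s.succ i)) := by
      refine (leftUnitor_inv_comp_naturality _ _ _ _ _ _ _ rfl ?_
        (zipFin_naturality n _ _ _ _ _ _)).symm
      exact (jointPreparation_productState n N (fun s => A s.succ) fun s => τ s.succ).symm
    rw [h1, zipFin_unitFin, Category.assoc, mapFin_comp]
    refine congrArg (fun t => unitFin n ≫ mapFin n _ _ t) (funext fun i => ?_)
    exact (productState_succ N (fun s => A s i) fun s => τ s i).symm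

end Wiring
end

noncomputable section

/-! ### Deterministic events, coarse-graining and marginals of states. -/

namespace CausalOPT

variable {C : Type u} [Category.{v} C] [MonoidalCategory C] [SymmetricCategory C]
  (T : CausalOPT C)

/-- An event is deterministic if it is a test with a single outcome. -/
def IsDet {A B : C} (f : A ⟶ B) : Prop := T.IsTest (fun _ : Unit => f)

/-- The unique way to discard a system. -/
def discard (A : C) : A ⟶ 𝟙_ C := (T.existsUnique_discard A).choose

theorem isDet_discard (A : C) : T.IsDet (T.discard A) := (T.existsUnique_discard A).choose_spec.1

variable {T}

theorem IsDet.eq_discard {A : C} {f : A ⟶ 𝟙_ C} (h : T.IsDet f) : f = T.discard A :=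
  (T.existsUnique_discard A).unique h (T.isDet_discard A)

theorem IsDet.eq_of_unit {A : C} {f g : A ⟶ 𝟙_ C} (hf : T.IsDet f) (hg : T.IsDet g) : f = g :=
  (T.existsUnique_discard A).unique hf hg

theorem IsDet.id (A : C) : T.IsDet (𝟙 A) := T.test_id A

theorem IsDet.comp {A B D : C} {f : A ⟶ B} {g : B ⟶ D} (hf : T.IsDet f) (hg : T.IsDet g) :
    T.IsDet (f ≫ g) :=
  T.test_relabel _ (Equiv.prodPUnit Unit).symm (T.test_comp _ _ hf hg)

theorem IsDet.tensor {A B A' B' : C} {f : A ⟶ B} {g : A' ⟶ B'} (hf : T.IsDet f)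
    (hg : T.IsDet g) : T.IsDet (f ⊗ₘ g) :=
  T.test_relabel _ (Equiv.prodPUnit Unit).symm (T.test_tensor _ _ hf hg)

theorem IsDet.whiskerLeft (A : C) {B D : C} {f : B ⟶ D} (hf : T.IsDet f) : T.IsDet (A ◁ f) := by
  rw [← id_tensorHom]
  exact (IsDet.id A).tensor hf

theorem IsDet.whiskerRight {B D : C} {f : B ⟶ D} (hf : T.IsDet f) (A : C) : T.IsDet (f ▷ A) := by
  rw [← tensorHom_id]
  exact hf.tensor (IsDet.id A)

theorem isDet_tensorμ (A B D E : C) : T.IsDet (tensorμ A B D E) :=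
  IsDet.comp (T.test_associator _ _ _) <| IsDet.comp (IsDet.whiskerLeft _
    (T.test_associator_inv _ _ _)) <| IsDet.comp (IsDet.whiskerLeft _ (IsDet.whiskerRight
    (T.test_braiding _ _) _)) <| IsDet.comp (IsDet.whiskerLeft _ (T.test_associator _ _ _))
    (T.test_associator_inv _ _ _)

theorem isDet_unitFin : ∀ n : ℕ, T.IsDet (unitFin (C := C) n)
  | 0 => IsDet.id _
  | n + 1 => IsDet.comp (T.test_leftUnitor_inv _) (IsDet.whiskerLeft _ (isDet_unitFin n))

theorem isDet_mapFin : ∀ (n : ℕ) {A B : Fin n → C} {f : ∀ i, A i ⟶ B i},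
    (∀ i, T.IsDet (f i)) → T.IsDet (mapFin n A B f)
  | 0, _, _, _, _ => IsDet.id _
  | n + 1, _, _, _, h => IsDet.tensor (h 0) (isDet_mapFin n fun i => h i.succ)

theorem isDet_effectFin : ∀ (n : ℕ) {A : Fin n → C} {e : ∀ i, A i ⟶ 𝟙_ C},
    (∀ i, T.IsDet (e i)) → T.IsDet (effectFin n A e)
  | 0, _, _, _ => IsDet.id _
  | n + 1, _, _, h =>
      IsDet.comp (IsDet.tensor (h 0) (isDet_effectFin n fun i => h i.succ)) (T.test_leftUnitor _)

theorem isDet_zipFin : ∀ (n : ℕ) (A B : Fin n → C), T.IsDet (zipFin n A B)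
  | 0, _, _ => T.test_leftUnitor _
  | n + 1, _, _ => IsDet.comp (isDet_tensorμ _ _ _ _) (IsDet.whiskerLeft _ (isDet_zipFin n _ _))

theorem isDet_productState (n : ℕ) {A : Fin n → C} {τ : ∀ i, 𝟙_ C ⟶ A i}
    (h : ∀ i, T.IsDet (τ i)) : T.IsDet (productState n A τ) :=
  (isDet_unitFin n).comp (isDet_mapFin n h)

theorem isDet_jointPreparation (n : ℕ) : ∀ (N : ℕ) {A : Fin N → Fin n → C}
    {σ : ∀ s, 𝟙_ C ⟶ tensorFin n (A s)}, (∀ s, T.IsDet (σ s)) →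
    T.IsDet (jointPreparation n N A σ)
  | 0, _, _, _ => isDet_unitFin n
  | N + 1, _, _, h =>
      IsDet.comp (T.test_leftUnitor_inv _) <| IsDet.comp
        (IsDet.tensor (h 0) (isDet_jointPreparation n N fun s => h s.succ)) (isDet_zipFin n _ _)

theorem isTest_effectFin : ∀ (n : ℕ) {V : Fin n → Type} [∀ i, Finite (V i)] {A : Fin n → C}
    {t : ∀ i, V i → (A i ⟶ 𝟙_ C)}, (∀ i, T.IsTest (t i)) →
    T.IsTest (fun x : ∀ i, V i => effectFin n A (fun i => t i (x i)))
  | 0, _, _, _, _, _ =>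
      T.test_relabel (fun _ : Unit => 𝟙 (𝟙_ C)) (Equiv.ofUnique _ _) (T.test_id _)
  | n + 1, V, _, _, _, h =>
      T.test_relabel _ ((Fin.consEquiv V).symm.trans (Equiv.prodPUnit _).symm) <|
        T.test_comp _ _ (T.test_tensor _ _ (h 0) (isTest_effectFin n fun i => h i.succ))
          (T.test_leftUnitor _)

theorem IsDet.prob_eq_one {a : 𝟙_ C ⟶ 𝟙_ C} (h : T.IsDet a) : T.prob a = 1 := by
  simpa using T.sum_prob _ h

/-! ### Coarse-graining -/

variable (T)

/-- In every circuit the probability of the event `g` is the sum of those of the `t x`, `x ∈ s`. -/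
def SumsTo {X : Type} {A B : C} (s : Finset X) (t : X → (A ⟶ B)) (g : A ⟶ B) : Prop :=
  ∀ (E : C) (r : 𝟙_ C ⟶ A ⊗ E) (a : B ⊗ E ⟶ 𝟙_ C),
    T.prob (r ≫ (g ▷ E) ≫ a) = ∑ x ∈ s, T.prob (r ≫ (t x ▷ E) ≫ a)

variable {T}

theorem sumsTo_singleton {X : Type} {A B : C} (x : X) (t : X → (A ⟶ B)) :
    T.SumsTo {x} t (t x) := by
  intro E r a
  rw [Finset.sum_singleton]

/-- Merging all outcomes gives a single-outcome measurement, and causality leaves only the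
discarding map. -/
theorem sumsTo_discard {X : Type} [Fintype X] [Nonempty X] {A : C} {t : X → (A ⟶ 𝟙_ C)}
    (h : T.IsTest t) : T.SumsTo Finset.univ t (T.discard A) := by
  obtain ⟨s, hs, hsum⟩ := T.coarseGrain t (fun _ => ()) (fun _ => ⟨Classical.arbitrary X, rfl⟩) h
  have hd : s () = T.discard A := IsDet.eq_discard hs
  intro E r a
  simpa [hd] using hsum E r a ()

theorem SumsTo.comp {X : Type} {A B D : C} {s : Finset X} {t : X → (A ⟶ B)} {g : A ⟶ B}
    (h : T.SumsTo s t g) (k : B ⟶ D) : T.SumsTo s (fun x => t x ≫ k) (g ≫ k) := by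
  intro E r a
  simpa only [comp_whiskerRight, Category.assoc] using h E r ((k ▷ E) ≫ a)

/-- Each factor is coarse-grained in turn while the other is absorbed into the surrounding circuit;
the ancilla in `SumsTo` makes room for this. -/
theorem SumsTo.tensor {X Y : Type} {A B A' B' : C} {s : Finset X} {s' : Finset Y}
    {t : X → (A ⟶ B)} {t' : Y → (A' ⟶ B')} {g : A ⟶ B} {g' : A' ⟶ B'}
    (h : T.SumsTo s t g) (h' : T.SumsTo s' t' g') :
    T.SumsTo (s ×ˢ s') (fun z : X × Y => t z.1 ⊗ₘ t' z.2) (g ⊗ₘ g') := by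
  intro E r a
  have e1 : ∀ (f : A ⟶ B) (f' : A' ⟶ B'), r ≫ ((f ⊗ₘ f') ▷ E) ≫ a =
      (r ≫ (A ◁ f') ▷ E ≫ (α_ A B' E).hom) ≫ (f ▷ (B' ⊗ E)) ≫ (α_ B B' E).inv ≫ a := by
    intro f f'
    rw [tensorHom_def']
    simp
  -- The second factor is braided to the front and back again.
  have e2 : ∀ (f : A ⟶ B) (f' : A' ⟶ B'), r ≫ ((f ⊗ₘ f') ▷ E) ≫ a =
      (r ≫ ((f ▷ A') ≫ (β_ B A').hom) ▷ E ≫ (α_ A' B E).hom) ≫ (f' ▷ (B ⊗ E)) ≫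
        (α_ B' B E).inv ≫ ((β_ B' B).hom ▷ E) ≫ a := by
    intro f f'
    rw [MonoidalCategory.tensorHom_def]
    simp only [comp_whiskerRight, Category.assoc, associator_inv_naturality_left_assoc,
      Iso.hom_inv_id_assoc]
    rw [← comp_whiskerRight_assoc (β_ B A').hom, ← comp_whiskerRight_assoc (_ ≫ _),
      Category.assoc, ← BraidedCategory.braiding_naturality_right_assoc]
    simp
  rw [e1, h, Finset.sum_product]
  refine Finset.sum_congr rfl fun x _ => ?_
  rw [← e1, e2, h']
  exact Finset.sum_congr rfl fun y _ => by rw [← e2]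

theorem SumsTo.map {X Y : Type} {A B : C} {s : Finset X} {t : Y → (A ⟶ B)} {g : A ⟶ B}
    (e : X ≃ Y) (h : T.SumsTo s (fun x => t (e x)) g) : T.SumsTo (s.map e.toEmbedding) t g := by
  intro E r a
  rw [h E r a, Finset.sum_map]
  rfl

theorem sumsTo_effectFin : ∀ (n : ℕ) {V : Fin n → Type} {A : Fin n → C} {s : ∀ i, Finset (V i)}
    {t : ∀ i, V i → (A i ⟶ 𝟙_ C)} {g : ∀ i, A i ⟶ 𝟙_ C},
    (∀ i, T.SumsTo (s i) (t i) (g i)) →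
    T.SumsTo (Fintype.piFinset s) (fun x : ∀ i, V i => effectFin n A (fun i => t i (x i)))
      (effectFin n A g)
  | 0, _, _, s, _, _, _ => by
    intro E r a
    rw [Fintype.piFinset_of_isEmpty, Finset.univ_unique, Finset.sum_singleton]
    rfl
  | n + 1, V, A, s, t, g, h => by
    have hs : Fintype.piFinset s = (s 0 ×ˢ Fintype.piFinset (Fin.tail s)).map
        (Fin.consEquiv V).toEmbedding := by
      simpa using Finset.filter_piFinset_eq_map_consEquiv s fun _ => True
    rw [hs]
    exact SumsTo.map (Fin.consEquiv V)
      ((SumsTo.tensor (h 0) (sumsTo_effectFin n fun i => h i.succ)).comp (λ_ (𝟙_ C)).hom)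

theorem SumsTo.prob_comp {X : Type} {A : C} {s : Finset X} {t : X → (A ⟶ 𝟙_ C)} {g : A ⟶ 𝟙_ C}
    (h : T.SumsTo s t g) (ρ : 𝟙_ C ⟶ A) :
    T.prob (ρ ≫ g) = ∑ x ∈ s, T.prob (ρ ≫ t x) := by
  simpa using h (𝟙_ C) (ρ ≫ (ρ_ A).inv) (ρ_ (𝟙_ C)).hom

/-! ### Marginals of states -/

/-- Discarding the parts one by one is discarding the whole, by uniqueness. -/
theorem mapFin_discard_comp (n : ℕ) {A : Fin n → C} (τ : ∀ i, 𝟙_ C ⟶ A i) :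
    mapFin n A A (fun i => T.discard (A i) ≫ τ i) =
      T.discard (tensorFin n A) ≫ productState n A τ := by
  have h : mapFin n A (fun _ => 𝟙_ C) (fun i => T.discard (A i)) =
      T.discard (tensorFin n A) ≫ unitFin n := by
    rw [← Category.comp_id (mapFin n A _ _), ← effectFin_unitFin n, ← Category.assoc]
    congr 1
    exact ((isDet_mapFin n fun i => T.isDet_discard _).comp
      (isDet_effectFin n fun i => IsDet.id _)).eq_discard
  rw [← mapFin_comp n A (fun _ => 𝟙_ C) A, h, Category.assoc, productState]

/-- The marginals of a state on many systems. -/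
theorem exists_marginal : ∀ (n : ℕ) (A : Fin n → C) (b : Fin n),
    ∃ t : tensorFin n A ⟶ A b, T.IsDet t ∧ ∀ (σ : 𝟙_ C ⟶ tensorFin n A)
      (ω : ∀ i, 𝟙_ C ⟶ A i) (D : ∀ i, A i ⟶ A i), (∀ i, i ≠ b → D i = T.discard (A i) ≫ ω i) →
      D b = 𝟙 (A b) → ω b = σ ≫ t → σ ≫ mapFin n A A D = productState n A ω
  | 0, _, b => b.elim0
  | n + 1, A, b => by
    refine Fin.cases ?_ (fun b => ?_) b
    · refine ⟨(𝟙 (A 0) ⊗ₘ T.discard (tensorFin n fun i => A i.succ)) ≫ (ρ_ (A 0)).hom,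
        IsDet.comp (IsDet.tensor (IsDet.id _) (T.isDet_discard _)) (T.test_rightUnitor _), ?_⟩
      intro σ ω D hD hb hω
      have key : ∀ {X Y : C} (σ : 𝟙_ C ⟶ X ⊗ Y) (d : Y ⟶ 𝟙_ C) (P : 𝟙_ C ⟶ Y),
          σ ≫ (𝟙 X ⊗ₘ d ≫ P) =
            (λ_ (𝟙_ C)).inv ≫ ((σ ≫ (𝟙 X ⊗ₘ d) ≫ (ρ_ X).hom) ⊗ₘ P) := by
        intro X Y σ d P
        rw [MonoidalCategory.tensorHom_def (_ ≫ _) P, unitors_inv_equal,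
          ← rightUnitor_inv_naturality_assoc]
        simp
      have h1 : mapFin (n + 1) A A D = 𝟙 (A 0) ⊗ₘ (T.discard (tensorFin n fun i => A i.succ) ≫
          productState n _ fun i => ω i.succ) := by
        rw [← mapFin_discard_comp, ← hb, mapFin]
        congr 2
        exact funext fun i => hD i.succ (Fin.succ_ne_zero i)
      rw [h1, productState_succ, hω]
      exact key _ _ _
    · obtain ⟨t, ht, h⟩ := exists_marginal n (fun i => A i.succ) b
      refine ⟨((T.discard (A 0) ⊗ₘ 𝟙 (tensorFin n fun i => A i.succ)) ≫
        (λ_ (tensorFin n fun i => A i.succ)).hom) ≫ t,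
        IsDet.comp (IsDet.comp (IsDet.tensor (T.isDet_discard _) (IsDet.id _))
          (T.test_leftUnitor _)) ht, ?_⟩
      intro σ ω D hD hb hω
      have key : ∀ {X Y : C} (σ : 𝟙_ C ⟶ X ⊗ Y) (d : X ⟶ 𝟙_ C) (τ : 𝟙_ C ⟶ X) (M : Y ⟶ Y)
          (P : 𝟙_ C ⟶ Y), (σ ≫ (d ⊗ₘ 𝟙 Y) ≫ (λ_ Y).hom) ≫ M = P →
          σ ≫ (d ≫ τ ⊗ₘ M) = (λ_ (𝟙_ C)).inv ≫ (τ ⊗ₘ P) := by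
        intro X Y σ d τ M P hP
        rw [tensorHom_def' τ P, ← leftUnitor_inv_naturality_assoc, ← hP, tensorHom_def' (d ≫ τ)]
        simp [whisker_exchange_assoc]
      have h1 : mapFin (n + 1) A A D = (T.discard (A 0) ≫ ω 0) ⊗ₘ
          mapFin n _ _ fun i => D i.succ := by
        rw [← hD 0 (Fin.succ_ne_zero b).symm]
        rfl
      rw [h1, productState_succ]
      refine key _ _ _ _ _ (h _ (fun i => ω i.succ) _ (fun i hi => hD i.succ ?_) hb ?_)
      · exact fun h => hi (Fin.succ_injective n h)
      · rw [hω]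
        exact (Category.assoc σ _ t).symm

end CausalOPT
end

noncomputable section

/-! ### Decorrelated sources and what pairs of parties can see of them. -/

namespace CausalOPT

variable {C : Type u} [Category.{v} C] [MonoidalCategory C] [SymmetricCategory C]
  {T : CausalOPT C}

/-- No-signalling: a deterministic operation whose output is discarded is itself a single-outcome
measurement, hence the discarding map. -/
theorem IsDet.comp_discard {A B : C} {f : A ⟶ B} (h : T.IsDet f) :
    f ≫ T.discard B = T.discard A := (h.comp (T.isDet_discard B)).eq_discard

theorem IsDet.comp_discard_comp {A D : C} {τ : 𝟙_ C ⟶ A} (h : T.IsDet τ) (f : 𝟙_ C ⟶ D) :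
    τ ≫ T.discard A ≫ f = f := by
  rw [← Category.assoc, h.comp_discard, ← (IsDet.id (𝟙_ C)).eq_discard, Category.id_comp]

/-- Discarding a trivial system and preparing it again does nothing. -/
theorem IsDet.discard_comp_of_eq_unit {A : C} (hA : A = 𝟙_ C) {τ : 𝟙_ C ⟶ A} (h : T.IsDet τ) :
    T.discard A ≫ τ = 𝟙 A := by
  subst hA
  exact ((T.isDet_discard _).comp h).eq_of_unit (IsDet.id _)

variable (T) in
/-- The projection from many systems to one of them. -/
def marginal {n : ℕ} (A : Fin n → C) (b : Fin n) : tensorFin n A ⟶ A b :=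
  (exists_marginal (T := T) n A b).choose

theorem isDet_marginal {n : ℕ} (A : Fin n → C) (b : Fin n) : T.IsDet (T.marginal A b) :=
  (exists_marginal n A b).choose_spec.1

/-- The product of the marginals of a state. -/
def decorrelate (T : CausalOPT C) {n : ℕ} {A : Fin n → C} (σ : 𝟙_ C ⟶ tensorFin n A) :
    𝟙_ C ⟶ tensorFin n A :=
  productState n A fun i => σ ≫ T.marginal A i

theorem isDet_decorrelate {n : ℕ} {A : Fin n → C} {σ : 𝟙_ C ⟶ tensorFin n A} (h : T.IsDet σ) :
    T.IsDet (T.decorrelate σ) :=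
  isDet_productState n fun i => h.comp (isDet_marginal A i)

open Classical in
/-- Discarding the systems outside `S` and preparing them again in the states `τ i`. -/
def reprepare (T : CausalOPT C) {n : ℕ} {A : Fin n → C} (S : Finset (Fin n))
    (τ : ∀ i, 𝟙_ C ⟶ A i) (i : Fin n) : A i ⟶ A i :=
  if i ∈ S then 𝟙 (A i) else T.discard (A i) ≫ τ i

theorem isDet_reprepare {n : ℕ} {A : Fin n → C} (S : Finset (Fin n))
    {τ : ∀ i, 𝟙_ C ⟶ A i} (h : ∀ i, T.IsDet (τ i)) (i : Fin n) :
    T.IsDet (T.reprepare S τ i) := by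
  rw [reprepare]
  split_ifs
  · exact IsDet.id _
  · exact (T.isDet_discard _).comp (h i)

/-- If at most one of the systems in `S` is nontrivial, correlations are invisible on `S`. -/
theorem decorrelate_comp_reprepare {n : ℕ} {A : Fin n → C} {σ : 𝟙_ C ⟶ tensorFin n A}
    (hσ : T.IsDet σ) (S : Finset (Fin n)) (c : Fin n) (hc : ∀ i ∈ S, i ≠ c → A i = 𝟙_ C) :
    T.decorrelate σ ≫ mapFin n A A (T.reprepare S fun i => σ ≫ T.marginal A i) =
      σ ≫ mapFin n A A (T.reprepare S fun i => σ ≫ T.marginal A i) := by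
  classical
  set τ : ∀ i, 𝟙_ C ⟶ A i := fun i => σ ≫ T.marginal A i with hτ
  have hdet : ∀ i, T.IsDet (τ i) := fun i => hσ.comp (isDet_marginal A i)
  have h1 : σ ≫ mapFin n A A (T.reprepare {c} τ) = productState n A τ := by
    refine (exists_marginal n A c).choose_spec.2 σ τ _ (fun i hi => ?_) ?_ rfl
    · rw [reprepare, if_neg (by simpa using hi)]
    · rw [reprepare, if_pos (by simp)]
  -- Resetting everything but `c` first is harmless: inside `S` the other systems are trivial, and
  -- outside `S` they are reset anyway.
  have h2 : mapFin n A A (T.reprepare S τ) =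
      mapFin n A A (T.reprepare {c} τ) ≫ mapFin n A A (T.reprepare S τ) := by
    rw [mapFin_comp]
    congr 1
    funext i
    by_cases hi : i = c
    · rw [reprepare.eq_def T {c}, if_pos (by simpa using hi), Category.id_comp]
    · rw [reprepare.eq_def T {c}, if_neg (by simpa using hi), reprepare]
      split_ifs with hS
      · rw [Category.comp_id, (hdet i).discard_comp_of_eq_unit (hc i hS hi)]
      · rw [Category.assoc, (hdet i).comp_discard_comp]
  change productState n A τ ≫ _ = _
  rw [h2, ← Category.assoc σ, h1, ← Category.assoc, productState_mapFin]
  congr 2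
  funext i
  rw [reprepare]
  split_ifs
  · rw [Category.comp_id]
  · rw [(hdet i).comp_discard_comp]

/-! ### Networks -/

section Network

variable {n N : ℕ} {A : Fin N → Fin n → C} {σ σ' : ∀ s, 𝟙_ C ⟶ tensorFin n (A s)}
  {V : Fin n → Type} [∀ i, Fintype (V i)]
  {t : ∀ i, V i → (tensorFin N (fun s => A s i) ⟶ 𝟙_ C)}

open Classical in
/-- The parties in `S` observe the outcomes `x i`, the others discard their systems. -/
def partialEffect (T : CausalOPT C) (t : ∀ i, V i → (tensorFin N (fun s => A s i) ⟶ 𝟙_ C))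
    (S : Finset (Fin n)) (x : ∀ i, V i) (i : Fin n) : tensorFin N (fun s => A s i) ⟶ 𝟙_ C :=
  if i ∈ S then t i (x i) else T.discard _

omit [∀ i, Fintype (V i)] in
-- Parties outside `S` may reset their systems before discarding them. Moved back into the sources,
-- these resets erase all differences that `S` cannot see.
theorem jointPreparation_comp_partialEffect_congr (S : Finset (Fin n)) (x : ∀ i, V i)
    {τ : ∀ s i, 𝟙_ C ⟶ A s i} (hτ : ∀ s i, T.IsDet (τ s i))
    (h : ∀ s, σ s ≫ mapFin n (A s) (A s) (T.reprepare S (τ s)) =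
      σ' s ≫ mapFin n (A s) (A s) (T.reprepare S (τ s))) :
    jointPreparation n N A σ ≫ effectFin n _ (T.partialEffect t S x) =
      jointPreparation n N A σ' ≫ effectFin n _ (T.partialEffect t S x) := by
  have he : effectFin n _ (T.partialEffect t S x) =
      mapFin n _ _ (fun i => mapFin N (fun s => A s i) (fun s => A s i)
        fun s => T.reprepare S (τ s) i) ≫ effectFin n _ (T.partialEffect t S x) := by
    rw [mapFin_effectFin]
    congr 1
    funext i
    by_cases hi : i ∈ S
    · simp only [reprepare, if_pos hi, mapFin_id, Category.id_comp]
    · rw [partialEffect, if_neg hi]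
      exact (isDet_mapFin N fun s => isDet_reprepare S (hτ s) i).comp_discard.symm
  rw [he, ← Category.assoc, ← Category.assoc, jointPreparation_mapFin, jointPreparation_mapFin]
  simp only [h]

theorem sum_prob_network (ht : ∀ i, T.IsTest (t i)) [∀ i, Nonempty (V i)]
    (ρ : 𝟙_ C ⟶ tensorFin n fun i => tensorFin N fun s => A s i) (S : Finset (Fin n))
    (x : ∀ i, V i) (s : Finset (∀ i, V i)) (hs : ∀ y, y ∈ s ↔ ∀ i ∈ S, y i = x i) :
    ∑ y ∈ s, T.prob (ρ ≫ effectFin n _ fun i => t i (y i)) =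
      T.prob (ρ ≫ effectFin n _ (T.partialEffect t S x)) := by
  classical
  have h : ∀ i, T.SumsTo (if i ∈ S then {x i} else Finset.univ) (t i)
      (T.partialEffect t S x i) := by
    intro i
    rw [partialEffect]
    split_ifs
    · exact sumsTo_singleton _ _
    · exact sumsTo_discard (ht i)
  rw [(sumsTo_effectFin n h).prob_comp]
  have hs' : s = Fintype.piFinset fun i => if i ∈ S then {x i} else Finset.univ := by
    ext y
    rw [hs, Fintype.mem_piFinset]
    refine forall_congr' fun i => ?_
    by_cases hi : i ∈ S <;> simp [hi]
  rw [hs']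

theorem prob_productState_effectFin : ∀ (n : ℕ) (A : Fin n → C) (τ : ∀ i, 𝟙_ C ⟶ A i)
    (e : ∀ i, A i ⟶ 𝟙_ C),
    T.prob (productState n A τ ≫ effectFin n A e) = ∏ i, T.prob (τ i ≫ e i)
  | 0, _, _, _ => by
    rw [Fin.prod_univ_zero, ← (IsDet.id (T := T) (𝟙_ C)).prob_eq_one]
    congr 1
    exact (congrArg (· ≫ 𝟙 (𝟙_ C)) (Category.comp_id _)).trans (Category.comp_id _)
  | n + 1, A, τ, e => by
    rw [productState_effectFin_succ, T.prob_comp, Fin.prod_univ_succ,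
      prob_productState_effectFin n]

variable (T) in
/-- The outcome distribution of a network. -/
def networkDist (σ : ∀ s, 𝟙_ C ⟶ tensorFin n (A s)) (hσ : ∀ s, T.IsDet (σ s))
    (t : ∀ i, V i → (tensorFin N (fun s => A s i) ⟶ 𝟙_ C)) (ht : ∀ i, T.IsTest (t i)) :
    PMF (∀ i, V i) :=
  PMF.ofFintype (fun x => ENNReal.ofReal
    (T.prob (jointPreparation n N A σ ≫ effectFin n _ fun i => t i (x i)))) <| by
    rw [← ENNReal.ofReal_sum_of_nonneg fun _ _ => T.prob_nonneg _, ENNReal.ofReal_eq_one]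
    exact T.sum_prob _ (T.test_relabel _ (Equiv.punitProd _).symm
      (T.test_comp _ _ (isDet_jointPreparation n N hσ) (isTest_effectFin n ht)))

theorem toReal_networkDist (hσ : ∀ s, T.IsDet (σ s)) (ht : ∀ i, T.IsTest (t i)) (x : ∀ i, V i) :
    (T.networkDist σ hσ t ht x).toReal =
      T.prob (jointPreparation n N A σ ≫ effectFin n _ fun i => t i (x i)) := by
  rw [networkDist, PMF.ofFintype_apply, ENNReal.toReal_ofReal (T.prob_nonneg _)]

theorem toReal_networkDist_map_pair (hσ : ∀ s, T.IsDet (σ s)) (ht : ∀ i, T.IsTest (t i))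
    [∀ i, Nonempty (V i)] (i j : Fin n) (x : ∀ i, V i) :
    ((T.networkDist σ hσ t ht).map (fun y => (y i, y j)) (x i, x j)).toReal =
      T.prob (jointPreparation n N A σ ≫ effectFin n _ (T.partialEffect t {i, j} x)) := by
  classical
  rw [PMF.toReal_map_apply]
  simp only [toReal_networkDist]
  exact sum_prob_network ht _ _ _ _ fun y => by simp

theorem toReal_networkDist_map (hσ : ∀ s, T.IsDet (σ s)) (ht : ∀ i, T.IsTest (t i))
    [∀ i, Nonempty (V i)] (i : Fin n) (x : ∀ i, V i) :
    ((T.networkDist σ hσ t ht).map (fun y => y i) (x i)).toReal =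
      T.prob (jointPreparation n N A σ ≫ effectFin n _ (T.partialEffect t {i} x)) := by
  classical
  rw [PMF.toReal_map_apply]
  simp only [toReal_networkDist]
  exact sum_prob_network ht _ _ _ _ fun y => by simp

theorem networkDist_map_pair_congr (hσ : ∀ s, T.IsDet (σ s)) (hσ' : ∀ s, T.IsDet (σ' s))
    (ht : ∀ i, T.IsTest (t i)) [∀ i, Nonempty (V i)] {i j : Fin n}
    {τ : ∀ s i, 𝟙_ C ⟶ A s i} (hτ : ∀ s i, T.IsDet (τ s i))
    (h : ∀ s, σ s ≫ mapFin n (A s) (A s) (T.reprepare {i, j} (τ s)) =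
      σ' s ≫ mapFin n (A s) (A s) (T.reprepare {i, j} (τ s))) :
    (T.networkDist σ hσ t ht).map (fun y => (y i, y j)) =
      (T.networkDist σ' hσ' t ht).map (fun y => (y i, y j)) := by
  ext ⟨a, b⟩
  rw [← ENNReal.toReal_eq_toReal_iff' (PMF.apply_ne_top _ _) (PMF.apply_ne_top _ _)]
  by_cases hx : ∃ x : ∀ i, V i, (x i, x j) = (a, b)
  · obtain ⟨x, hx⟩ := hx
    rw [← hx, toReal_networkDist_map_pair, toReal_networkDist_map_pair,
      jointPreparation_comp_partialEffect_congr _ _ hτ h]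
  -- This happens only for i = j and a ≠ b; both probabilities are then empty sums.
  · classical
    rw [PMF.toReal_map_apply, PMF.toReal_map_apply,
      Finset.filter_false_of_mem fun x _ hx' => hx ⟨x, hx'⟩, Finset.sum_empty, Finset.sum_empty]

open Classical in
/-- The preparations with those in `U` replaced by the product of their marginals. -/
def decorrelateOn (T : CausalOPT C) (σ : ∀ s, 𝟙_ C ⟶ tensorFin n (A s)) (U : Set (Fin N))
    (s : Fin N) : 𝟙_ C ⟶ tensorFin n (A s) :=
  if s ∈ U then T.decorrelate (σ s) else σ s

theorem isDet_decorrelateOn (hσ : ∀ s, T.IsDet (σ s)) (U : Set (Fin N)) (s : Fin N) :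
    T.IsDet (T.decorrelateOn σ U s) := by
  rw [decorrelateOn]
  split_ifs
  · exact isDet_decorrelate (hσ s)
  · exact hσ s

/-- Correlations of a source are invisible to a pair of parties that it does not connect. -/
theorem networkDist_decorrelateOn_map_pair (hσ : ∀ s, T.IsDet (σ s)) (ht : ∀ i, T.IsTest (t i))
    [∀ i, Nonempty (V i)] {U U' : Set (Fin N)} (hU : U ⊆ U') {i j : Fin n}
    (h : ∀ s ∈ U', s ∉ U → i = j ∨ A s i = 𝟙_ C ∨ A s j = 𝟙_ C) :
    (T.networkDist (T.decorrelateOn σ U) (isDet_decorrelateOn hσ U) t ht).map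
        (fun y => (y i, y j)) =
      (T.networkDist (T.decorrelateOn σ U') (isDet_decorrelateOn hσ U') t ht).map
        (fun y => (y i, y j)) := by
  refine networkDist_map_pair_congr _ _ ht (τ := fun s i => σ s ≫ T.marginal (A s) i)
    (fun s i => (hσ s).comp (isDet_marginal _ i)) fun s => ?_
  by_cases h1 : s ∈ U
  · rw [decorrelateOn, decorrelateOn, if_pos h1, if_pos (hU h1)]
  by_cases h2 : s ∈ U'
  · rw [decorrelateOn, decorrelateOn, if_neg h1, if_pos h2]
    -- In each case the index kept is the only one of the pair that can hold a nontrivial system.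
    rcases h s h2 h1 with rfl | h | h
    · refine (decorrelate_comp_reprepare (hσ s) _ i fun k hk hki => ?_).symm
      exact absurd (by simpa using hk) hki
    · refine (decorrelate_comp_reprepare (hσ s) _ j fun k hk hkj => ?_).symm
      rcases Finset.mem_insert.mp hk with rfl | hk
      · exact h
      · exact absurd (Finset.mem_singleton.mp hk) hkj
    · refine (decorrelate_comp_reprepare (hσ s) _ i fun k hk hki => ?_).symm
      rcases Finset.mem_insert.mp hk with rfl | hk
      · exact absurd rfl hki
      · exact Finset.mem_singleton.mp hk ▸ h
  · rw [decorrelateOn, decorrelateOn, if_neg h1, if_neg h2]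

/-- Without correlated sources the outcomes are independent. -/
theorem mutualInfo_networkDist_decorrelateOn_univ (hσ : ∀ s, T.IsDet (σ s))
    (ht : ∀ i, T.IsTest (t i)) [∀ i, Nonempty (V i)] {i j : Fin n} (hij : i ≠ j) :
    mutualInfo (T.networkDist (T.decorrelateOn σ Set.univ) (isDet_decorrelateOn hσ _) t ht) i j =
      0 := by
  classical
  -- With all sources decorrelated, party i holds the state `ω i` independently of the others.
  set ω : ∀ i, 𝟙_ C ⟶ tensorFin N fun s => A s i := fun i =>
    productState N (fun s => A s i) fun s => σ s ≫ T.marginal (A s) i with hω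
  have hJ : jointPreparation n N A (T.decorrelateOn σ Set.univ) = productState n _ ω := by
    rw [hω, ← jointPreparation_productState]
    congr 1
    funext s
    rw [decorrelateOn, if_pos (Set.mem_univ s), decorrelate]
  have hprod : ∀ (S : Finset (Fin n)) (x : ∀ i, V i),
      T.prob (jointPreparation n N A (T.decorrelateOn σ Set.univ) ≫
        effectFin n _ (T.partialEffect t S x)) = ∏ k ∈ S, T.prob (ω k ≫ t k (x k)) := by
    intro S x
    rw [hJ, prob_productState_effectFin, ← Finset.prod_subset (Finset.subset_univ S)]
    · refine Finset.prod_congr rfl fun k hk => ?_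
      rw [partialEffect, if_pos hk]
    · intro k _ hk
      rw [partialEffect, if_neg hk]
      exact ((isDet_productState N fun s => (hσ s).comp (isDet_marginal _ k)).comp
        (T.isDet_discard _)).prob_eq_one
  refine mutualInfo_eq_zero_of_indep _ i j fun x => ?_
  have hdet := isDet_decorrelateOn hσ Set.univ
  have hi := (toReal_networkDist_map hdet ht i x).trans (hprod {i} x)
  have hj := (toReal_networkDist_map hdet ht j x).trans (hprod {j} x)
  have hk := (toReal_networkDist_map_pair hdet ht i j x).trans (hprod {i, j} x)
  rw [Finset.prod_singleton] at hi hj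
  rw [Finset.prod_pair hij, ← hi, ← hj] at hk
  exact hk

end Network

end CausalOPT

/-! ### The inequality for networks. -/

section GBN

variable {C : Type u} [Category.{v} C] [MonoidalCategory C] [SymmetricCategory C]

open CausalOPT in
theorem CompatibleWithGBN.commonAncestorInequality {T : CausalOPT C} {n m : ℕ} (hm : 1 ≤ m)
    {V : Fin n → Type} [∀ i, Fintype (V i)] {p : PMF (∀ i, V i)} (hp : CompatibleWithGBN T m p)
    (f : Fin (m + 1) ↪ Fin n) : CommonAncestorInequality m p f := by
  classical
  obtain ⟨G, hG⟩ := hp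
  obtain ⟨x₀, -⟩ := p.support_nonempty
  have : ∀ i, Nonempty (V i) := fun i => ⟨x₀ i⟩
  -- Indices are natural numbers for the recursion; the wrap-around beyond m is never used.
  let g : ℕ → Fin n := fun k => f (Fin.ofNat (m + 1) k)
  have hg : ∀ k (hk : k < m + 1), g k = f ⟨k, hk⟩ := fun k hk =>
    congrArg f (Fin.ext (Nat.mod_eq_of_lt hk))
  have hinj : ∀ {k l}, k < m + 1 → l < m + 1 → g k = g l → k = l := by
    intro k l hk hl h
    rw [hg k hk, hg l hl] at h
    exact congrArg Fin.val (f.injective h)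
  let U : ℕ → Set (Fin (n.choose m)) := fun d => {s | ∃ j < d, g j ∉ (G.order s).1}
  have hUmono : ∀ d, U d ⊆ U (d + 1) := fun d s ⟨j, hj, h⟩ => ⟨j, by omega, h⟩
  let P : Set (Fin (n.choose m)) → PMF (∀ i, V i) := fun W =>
    T.networkDist (T.decorrelateOn G.prep W) (isDet_decorrelateOn G.prep_test W) G.meas G.meas_test
  have hpair : ∀ {W W' : Set (Fin (n.choose m))}, W ⊆ W' → ∀ {i j : Fin n},
      (∀ s ∈ W', s ∉ W → i = j ∨ i ∉ (G.order s).1 ∨ j ∉ (G.order s).1) →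
      (P W).map (fun y => (y i, y j)) = (P W').map (fun y => (y i, y j)) := by
    intro W W' hW i j h
    refine networkDist_decorrelateOn_map_pair G.prep_test G.meas_test hW fun s h1 h2 => ?_
    exact (h s h1 h2).imp_right fun h => h.imp (fun h => if_neg h) fun h => if_neg h
  -- A source in `U (d + 1)` but not in `U d` must miss `g d`.
  have hstep : ∀ d k, mutualInfo (P (U d)) (g d) (g k) =
      mutualInfo (P (U (d + 1))) (g d) (g k) := by
    refine fun d k => mutualInfo_congr (hpair (hUmono d) fun s ⟨j, hj, hs⟩ h2 => Or.inr (Or.inl ?_))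
    rcases Nat.lt_succ_iff_lt_or_eq.mp hj with hj | rfl
    · exact absurd ⟨j, hj, hs⟩ h2
    · exact hs
  have hP0 : P ∅ = p := by
    ext x
    rw [← ENNReal.toReal_eq_toReal_iff' (PMF.apply_ne_top _ _) (PMF.apply_ne_top _ _), hG,
      toReal_networkDist, GBN.circuit]
    congr 3
    funext s
    rw [decorrelateOn, if_neg (Set.notMem_empty s)]
  have hU0 : U 0 = ∅ := by
    ext s
    simp [U]
  -- The degenerate pair `(i, i)` sees no correlations at all, so every source may be decorrelated.
  have hent : ∀ W i, entropyVar (P W) i = entropyVar p i := by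
    intro W i
    have h := congrArg (PMF.map Prod.fst)
      (hpair (Set.empty_subset W) (i := i) (j := i) fun _ _ _ => Or.inl rfl)
    simp only [PMF.map_comp] at h
    rw [← entropyVar_congr h, hP0]
  have hlast : ∀ d, d + 1 = m → mutualInfo (P (U d)) (g d) (g (d + 1)) = 0 := by
    rintro d rfl
    have hne : g d ≠ g (d + 1) := fun h => absurd (hinj (by omega) (by omega) h) (by omega)
    -- All remaining sources may be decorrelated unless one reaches both parties; such a source
    -- would contain the m + 1 parties in the image of `f`.
    rw [mutualInfo_congr (hpair (Set.subset_univ (U d)) fun s _ hs => ?_)]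
    · exact mutualInfo_networkDist_decorrelateOn_univ G.prep_test G.meas_test hne
    · by_contra! hcon
      obtain ⟨-, h1, h2⟩ := hcon
      have hsub : Finset.univ.map f ⊆ (G.order s).1 := by
        intro i hi
        obtain ⟨k, -, rfl⟩ := Finset.mem_map.mp hi
        rw [← hg k.1 k.2]
        rcases lt_trichotomy k.1 d with hk | hk | hk
        · by_contra hk'
          exact hs ⟨k.1, hk, hk'⟩
        · rwa [hk]
        · rwa [show k.1 = d + 1 by omega]
      have hcard := Finset.card_le_card hsub
      rw [(G.order s).2, Finset.card_map, Finset.card_univ, Fintype.card_fin] at hcard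
      omega
  obtain ⟨M, rfl⟩ : ∃ M, m = M + 1 := ⟨m - 1, by omega⟩
  have key := sum_le_of_recursion (M + 1) (fun k => entropyVar p (g k))
    (fun d k => mutualInfo (P (U d)) (g d) (g k))
    (fun d k _ _ => (mutualInfo_le_entropyVar _ _ _).trans (hent _ _).le)
    (fun d k _ _ => by
      -- The triangle inequality needs a single distribution, so the left side is moved to `P (U (d
      -- + 1))`.
      rw [hstep d, hstep d, ← hent (U (d + 1)) (g d)]
      exact mutualInfo_add_le _ _ _ _)
    (fun d hd => (hlast d hd).le) M 0 (by omega)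
  rw [hU0, hP0, Finset.sum_range, Finset.sum_range] at key
  rw [CommonAncestorInequality]
  convert key using 3 with k _ k _
  · rw [hg 0 (by omega)]
    rfl
  · rw [hg _ (by omega)]
    congr 1
    exact Fin.ext (by simp [add_comm])
  · simp only [Nat.add_sub_cancel, show M + 1 - k.1 - 1 = M - k.1 by omega]
  · rw [hg _ (by omega)]
    congr 1
    exact Fin.ext (by simp)

end GBN

end

theorem mainTheorem5 {C : Type u} [Category.{v} C] [MonoidalCategory C] [SymmetricCategory C]
    (T : CausalOPT C) (m : ℕ) (hm : 1 ≤ m) :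
    -- the inequality for networks of shape `G_{m+1,m}`
    (∀ (V : Fin (m + 1) → Type) [∀ i, Fintype (V i)] (p : PMF (∀ i, V i)),
      CompatibleWithGBN T m p → CommonAncestorInequality m p id) ∧
    -- copies of a fair coin violate it and are incompatible with `G_{m+1,m}`
    (¬ CommonAncestorInequality m (coinCopies (m + 1)) id ∧
      ¬ CompatibleWithGBN T m (coinCopies (m + 1))) ∧
    -- constraints for every `G_{n,m}` with `n > m`
    (∀ n : ℕ, m < n →
      (∀ (V : Fin n → Type) [∀ i, Fintype (V i)] (p : PMF (∀ i, V i)),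
        CompatibleWithGBN T m p →
          ∀ f : Fin (m + 1) ↪ Fin n, CommonAncestorInequality m p f) ∧
      (∀ f : Fin (m + 1) ↪ Fin n, ¬ CommonAncestorInequality m (coinCopies n) f) ∧
      ¬ CompatibleWithGBN T m (coinCopies n)) := by
  refine ⟨fun V _ p hp => hp.commonAncestorInequality hm (Function.Embedding.refl _),
    ⟨not_commonAncestorInequality_coinCopies hm _, fun h =>
      not_commonAncestorInequality_coinCopies hm _
        (h.commonAncestorInequality hm (Function.Embedding.refl _))⟩, fun n hn =>
    ⟨fun V _ p hp => hp.commonAncestorInequality hm, fun f =>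
      not_commonAncestorInequality_coinCopies hm f, fun h => ?_⟩⟩
  exact not_commonAncestorInequality_coinCopies hm _
    (h.commonAncestorInequality hm (Fin.castLEEmb (Nat.succ_le_of_lt hn)))
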